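/- Let $n \ge 0$ be an integer and let $C$ be a nonempty set. Let $B^+_{n,C}$ be the monoid of positive $C$-coloured braids, that is, the monoid presented by the generators $\sigma_i^a$ (where $a$ is a superscript label, not an exponent) for $i \in \{1, \dots, n\}$ and $a \in C$, subject to the relations $$\sigma_i^a \sigma_j^b = \sigma_j^b \sigma_i^a \quad \text{for } |i-j| \ge 2 \text{ and } a, b \in C,$$ $$\sigma_i^a \sigma_j^b \sigma_i^c = \sigma_j^c \sigma_i^b \sigma_j^a \quad \text{for } |i-j| = 1 \text{ and } a, b, c \in C.$$ Then $B^+_{n,C}$ is left cancellative and right cancellative: for all $x, y, z \in B^+_{n,C}$, $xy = xz$ implies $y = z$, and $yx = zx$ implies $y = z$. -/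

import Mathlib

/-- The generator `σ_i^a`, as a one-letter word. The positions `1, …, n` are represented by
`Fin n` (shifted by one; the relations depend only on differences of positions). -/
def colSigma {n : ℕ} {C : Type*} (i : Fin n) (a : C) : FreeMonoid (Fin n × C) :=
  FreeMonoid.of (i, a)

/-- The defining relations of the monoid of positive `C`-coloured braids. -/
inductive ColBraidRel (n : ℕ) (C : Type*) :
    FreeMonoid (Fin n × C) → FreeMonoid (Fin n × C) → Prop
  | comm (i j : Fin n) (a b : C) (h : 2 ≤ |((i : ℕ) : ℤ) - ((j : ℕ) : ℤ)|) :
      ColBraidRel n C (colSigma i a * colSigma j b) (colSigma j b * colSigma i a)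
  | braid (i j : Fin n) (a b c : C) (h : |((i : ℕ) : ℤ) - ((j : ℕ) : ℤ)| = 1) :
      ColBraidRel n C (colSigma i a * colSigma j b * colSigma i c)
        (colSigma j c * colSigma i b * colSigma j a)

/-- The monoid `B⁺_{n,C}` of positive `C`-coloured braids, with generators `σ_i^a` for
`1 ≤ i ≤ n` and `a ∈ C`. -/
abbrev ColBraidMonoid (n : ℕ) (C : Type*) : Type _ :=
  PresentedMonoid (ColBraidRel n C)

/-!
The colours play no role beyond the three-letter relations, and the linear shape of the braid
diagram plays none at all, so the positions may form the vertices of any simple graph, with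
adjacent vertices braiding and non-adjacent ones commuting.

Following Garside, one shows by induction on length that every equality `σ_i^a x = σ_j^d y` comes
from a single defining relation at the front; the case of equal first letters is left
cancellation. A chain of elementary rewritings of words changes the first letter through
intermediate ones `σ_k^e`, and two consecutive changes compose into one because they give two
factorisations of the shorter tail of `σ_k^e`, which are related by induction. Three mutually
adjacent first letters never occur, since generators on a triangle have no common multiple.
Reading words backwards preserves the relations and gives right cancellation.
-/

/-- The defining relations of the `C`-coloured Artin monoid of a simple graph `G`: letters at
adjacent vertices satisfy the coloured braid relation, letters at distinct non-adjacent vertices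
(the edges of `Gᶜ`) commute. -/
inductive ColArtinRel {V : Type*} (G : SimpleGraph V) (C : Type*) :
    FreeMonoid (V × C) → FreeMonoid (V × C) → Prop
  | comm {i j : V} (hij : Gᶜ.Adj i j) (a b : C) :
      ColArtinRel G C (.of (i, a) * .of (j, b)) (.of (j, b) * .of (i, a))
  | braid {i j : V} (hij : G.Adj i j) (a b c : C) :
      ColArtinRel G C (.of (i, a) * .of (j, b) * .of (i, c))
        (.of (j, c) * .of (i, b) * .of (j, a))

/-- The `C`-coloured Artin monoid (of small type) of a simple graph. The monoid of positive
coloured braids is the case of a path, see `colBraidRel_eq_colArtinRel`. -/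
abbrev ColArtinMonoid {V : Type*} (G : SimpleGraph V) (C : Type*) : Type _ :=
  PresentedMonoid (ColArtinRel G C)

namespace ColArtinMonoid

variable {V C : Type*} {G : SimpleGraph V} {i j k : V} {a b c d e : C}

/-- The generator `σ_i^a` of a coloured Artin monoid. -/
def σ (i : V) (a : C) : ColArtinMonoid G C :=
  PresentedMonoid.of _ (i, a)

@[elab_as_elim]
theorem σ_induction {P : ColArtinMonoid G C → Prop} (x : ColArtinMonoid G C) (one : P 1)
    (σ_mul : ∀ i a y, P y → P (σ i a * y)) : P x := by
  induction x using PresentedMonoid.inductionOn with | _ u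
  induction u using FreeMonoid.recOn with
  | one => exact one
  | of_mul p u ih => exact σ_mul p.1 p.2 _ ih

theorem σ_mul_σ_comm (hij : Gᶜ.Adj i j) (a b : C) :
    (σ i a * σ j b : ColArtinMonoid G C) = σ j b * σ i a :=
  PresentedMonoid.mk_eq_mk_of_rel (.comm hij a b)

theorem σ_mul_σ_mul_σ (hij : G.Adj i j) (a b c : C) :
    (σ i a * σ j b * σ i c : ColArtinMonoid G C) = σ j c * σ i b * σ j a :=
  PresentedMonoid.mk_eq_mk_of_rel (.braid hij a b c)

theorem σ_mul_left_comm (hij : Gᶜ.Adj i j) (a b : C) (x : ColArtinMonoid G C) :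
    σ i a * (σ j b * x) = σ j b * (σ i a * x) := by
  simpa only [mul_assoc] using congrArg (· * x) (σ_mul_σ_comm hij a b)

theorem σ_mul_left_braid (hij : G.Adj i j) (a b c : C) (x : ColArtinMonoid G C) :
    σ i a * (σ j b * (σ i c * x)) = σ j c * (σ i b * (σ j a * x)) := by
  simpa only [mul_assoc] using congrArg (· * x) (σ_mul_σ_mul_σ hij a b c)

theorem σ_mul_path_from_center (hik : G.Adj i k) (hkj : G.Adj k j) (hij : Gᶜ.Adj i j)
    (a b c d e : C) (x : ColArtinMonoid G C) :
    σ k a * (σ i b * (σ j c * (σ k d * (σ i e * x)))) =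
      σ j e * (σ k c * (σ j a * (σ i d * (σ k b * x)))) := calc
  _ = σ k a * (σ j c * (σ i b * (σ k d * (σ i e * x)))) := by rw [σ_mul_left_comm hij]
  _ = σ k a * (σ j c * (σ k e * (σ i d * (σ k b * x)))) := by rw [σ_mul_left_braid hik]
  _ = σ j e * (σ k c * (σ j a * (σ i d * (σ k b * x)))) := σ_mul_left_braid hkj ..

theorem σ_mul_path_from_end (hik : G.Adj i k) (hkj : G.Adj k j) (hij : Gᶜ.Adj i j)
    (a b c d e : C) (x : ColArtinMonoid G C) :
    σ i a * (σ k b * (σ j c * (σ k d * (σ i e * x)))) =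
      σ j d * (σ k e * (σ i c * (σ k a * (σ j b * x)))) := calc
  _ = σ i a * (σ j d * (σ k c * (σ j b * (σ i e * x)))) := by rw [σ_mul_left_braid hkj]
  _ = σ j d * (σ i a * (σ k c * (σ i e * (σ j b * x)))) := by
    rw [σ_mul_left_comm hij, σ_mul_left_comm hij]
  _ = σ j d * (σ k e * (σ i c * (σ k a * (σ j b * x)))) := by rw [σ_mul_left_braid hik]

/-- The length homomorphism, with values in the multiplicative copy of `ℕ`; it exists because the
defining relations are homogeneous. -/
def lengthHom (G : SimpleGraph V) (C : Type*) : ColArtinMonoid G C →* Multiplicative ℕ :=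
  PresentedMonoid.lift (fun _ => .ofAdd 1) (by rintro _ _ (_ | _) <;> simp)

/-- The number of letters of any word representing an element of a coloured Artin monoid. -/
def length (x : ColArtinMonoid G C) : ℕ := (lengthHom G C x).toAdd

theorem length_mul (x y : ColArtinMonoid G C) : length (x * y) = length x + length y := by
  simp [length]

theorem length_σ_mul (i : V) (a : C) (x : ColArtinMonoid G C) :
    length (σ i a * x) = length x + 1 := by
  rw [length_mul, add_comm]
  rfl

theorem length_mk_of_mul (i : V) (a : C) (u : FreeMonoid (V × C)) :
    length (PresentedMonoid.mk (ColArtinRel G C) (.of (i, a) * u)) =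
      length (PresentedMonoid.mk (ColArtinRel G C) u) + 1 :=
  length_σ_mul i a (PresentedMonoid.mk _ u)

/-- `FrontRel i a x j d y` says that the equality `σ i a * x = σ j d * y` is an instance of `rfl`,
or of a defining relation applied to the first two or three letters. -/
inductive FrontRel : V → C → ColArtinMonoid G C → V → C → ColArtinMonoid G C → Prop
  | refl (i : V) (a : C) (x : ColArtinMonoid G C) : FrontRel i a x i a x
  | comm {i j : V} (hij : Gᶜ.Adj i j) (a d : C) (z : ColArtinMonoid G C) :
      FrontRel i a (σ j d * z) j d (σ i a * z)
  | braid {i j : V} (hij : G.Adj i j) (a b d : C) (z : ColArtinMonoid G C) :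
      FrontRel i a (σ j b * (σ i d * z)) j d (σ i b * (σ j a * z))

namespace FrontRel

variable {x y : ColArtinMonoid G C}

theorem symm (h : FrontRel i a x j d y) : FrontRel j d y i a x := by
  cases h with
  | refl => exact .refl ..
  | comm hij => exact .comm hij.symm ..
  | braid hij => exact .braid hij.symm ..

theorem mul_right (h : FrontRel i a x j d y) (w : ColArtinMonoid G C) :
    FrontRel i a (x * w) j d (y * w) := by
  cases h with
  | refl => exact .refl ..
  | comm hij => simpa only [mul_assoc] using .comm hij ..
  | braid hij => simpa only [mul_assoc] using .braid hij ..

theorem eq_of_same_vertex (h : FrontRel i a x i d y) : a = d ∧ x = y := by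
  cases h with
  | refl => exact ⟨rfl, rfl⟩
  | comm hii => exact (hii.ne rfl).elim
  | braid hii => exact (hii.ne rfl).elim

theorem exists_of_compl_adj (h : FrontRel i a x j d y) (hij : Gᶜ.Adj i j) :
    ∃ z, x = σ j d * z ∧ y = σ i a * z := by
  cases h with
  | refl => exact (hij.ne rfl).elim
  | comm => exact ⟨_, rfl, rfl⟩
  | braid hij' => exact (hij.2 hij').elim

theorem exists_of_adj (h : FrontRel i a x j d y) (hij : G.Adj i j) :
    ∃ b z, x = σ j b * (σ i d * z) ∧ y = σ i b * (σ j a * z) := by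
  cases h with
  | refl => exact (hij.ne rfl).elim
  | comm hij' => exact (hij'.2 hij).elim
  | braid => exact ⟨_, _, rfl, rfl⟩

end FrontRel

/-- Every equality `σ i a * x = σ j d * y` with `x` of length less than `L` comes from a single
relation at the front: the induction hypothesis in the proof of `frontRel_of_σ_mul_eq`. -/
def FrontRelBelow (G : SimpleGraph V) (C : Type*) (L : ℕ) : Prop :=
  ∀ ⦃i j : V⦄ ⦃a d : C⦄ ⦃x y : ColArtinMonoid G C⦄, length x < L →
    σ i a * x = σ j d * y → FrontRel i a x j d y

namespace FrontRelBelow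

variable {L : ℕ} {x y w : ColArtinMonoid G C}

/-- Infinite descent: cancelling the first letters by the braid relation of `i` and `j` leaves an
equality of the same shape between shorter elements, with the triangle rotated. -/
theorem σ_mul_ne_of_triangle {i j k : V} {a b c : C} {x y : ColArtinMonoid G C}
    (H : FrontRelBelow G C L) (hij : G.Adj i j) (hjk : G.Adj j k)
    (hki : G.Adj k i) (hx : length x < L) : σ i a * x ≠ σ j b * (σ k c * y) := by
  intro h
  have hyx : length y < length x := by
    have hlen := congrArg length h
    simp only [length_σ_mul] at hlen
    omega
  obtain ⟨b', z, -, hz⟩ := (H hx h).exists_of_adj hij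
  exact H.σ_mul_ne_of_triangle hki hij hjk (hyx.trans hx) hz
termination_by length x

theorem trans_comm_comm (H : FrontRelBelow G C L) (hik : Gᶜ.Adj i k) (hkj : Gᶜ.Adj k j)
    (hx : length x < L) (h : σ i a * x = σ j d * y) :
    FrontRel i a (σ k e * x) j d (σ k e * y) := by
  cases H hx h with
  | refl => exact .refl ..
  | comm hij a d z =>
    rw [σ_mul_left_comm hkj, σ_mul_left_comm hik.symm]
    exact .comm hij ..
  | braid hij a b d z =>
    rw [σ_mul_left_comm hkj, σ_mul_left_comm hik.symm, σ_mul_left_comm hik.symm,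
      σ_mul_left_comm hkj]
    exact .braid hij ..

theorem trans_comm_braid (H : FrontRelBelow G C L) (hik : Gᶜ.Adj i k) (hkj : G.Adj k j)
    (hx : length x < L) (h : σ i a * x = σ j b * (σ k d * y)) :
    FrontRel i a (σ k e * x) j d (σ k b * (σ j e * y)) := by
  have hlen := congrArg length h
  simp only [length_σ_mul] at hlen
  obtain rfl | hne := eq_or_ne i j
  · exact (hik.2 hkj.symm).elim
  by_cases hij : G.Adj i j
  · obtain ⟨c, u, rfl, hu⟩ := (H hx h).exists_of_adj hij
    obtain ⟨t, rfl, ht⟩ := (H (by omega) hu).exists_of_compl_adj hik.symm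
    simp only [length_σ_mul] at hx
    obtain ⟨f, s, rfl, rfl⟩ := (H (by omega) ht).exists_of_adj hkj.symm
    rw [σ_mul_left_comm hik b f, ← σ_mul_path_from_center hij hkj.symm hik f d c b e,
      σ_mul_path_from_end hkj hij.symm hik.symm b e c f a]
    exact .braid hij ..
  · have hij : Gᶜ.Adj i j := ⟨hne, hij⟩
    obtain ⟨u, rfl, hu⟩ := (H hx h).exists_of_compl_adj hij
    obtain ⟨t, rfl, rfl⟩ := (H (by omega) hu).exists_of_compl_adj hik.symm
    rw [σ_mul_left_braid hkj, σ_mul_left_comm hij.symm, σ_mul_left_comm hik.symm]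
    exact .comm hij ..

theorem trans_braid_braid (H : FrontRelBelow G C L) (hik : G.Adj i k) (hkj : G.Adj k j)
    (hx : length x + 1 < L) (h : σ i b * (σ k a * x) = σ j c * (σ k d * y)) :
    FrontRel i a (σ k b * (σ i e * x)) j d (σ k c * (σ j e * y)) := by
  have hkx : length (σ k a * x) < L := by simp only [length_σ_mul]; omega
  have hlen := congrArg length h
  simp only [length_σ_mul] at hlen
  obtain rfl | hne := eq_or_ne i j
  · obtain ⟨rfl, h'⟩ := (H hkx h).eq_of_same_vertex
    obtain ⟨rfl, rfl⟩ := (H (by omega) h').eq_of_same_vertex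
    exact .refl ..
  by_cases hij : G.Adj i j
  · exact (H.σ_mul_ne_of_triangle hij hkj.symm hik.symm hkx h).elim
  have hij : Gᶜ.Adj i j := ⟨hne, hij⟩
  obtain ⟨u, hu, hu'⟩ := (H hkx h).exists_of_compl_adj hij
  obtain ⟨f, s, rfl, rfl⟩ := (H (by omega) hu).exists_of_adj hkj
  obtain ⟨g, t, rfl, ht⟩ := (H (by omega) hu').exists_of_adj hik.symm
  simp only [length_σ_mul] at hx hlen
  obtain ⟨rfl, hst⟩ := (H (by simp only [length_σ_mul]; omega) ht).eq_of_same_vertex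
  obtain ⟨r, rfl, rfl⟩ := (H (by omega) hst).exists_of_compl_adj hij.symm
  rw [σ_mul_path_from_center hik hkj hij b e f c d,
    σ_mul_path_from_center hkj.symm hik.symm hij.symm c e f b a, σ_mul_left_comm hij c b]
  exact .comm hij ..

theorem trans (H : FrontRelBelow G C L) (hw : length w ≤ L) (h₁ : FrontRel i a x k e w)
    (h₂ : FrontRel k e w j d y) : FrontRel i a x j d y := by
  cases h₁ with
  | refl => exact h₂
  | comm hik _ _ z =>
    have hz : length z < L := by rwa [length_σ_mul] at hw
    generalize h : σ i a * z = w at h₂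
    cases h₂ with
    | refl => exact h ▸ .comm hik ..
    | comm hkj => exact H.trans_comm_comm hik hkj hz h
    | braid hkj => exact H.trans_comm_braid hik hkj hz h
  | braid hik _ b _ z =>
    have hz : length z + 1 < L := by rwa [length_σ_mul, length_σ_mul] at hw
    generalize h : σ i b * (σ k a * z) = w at h₂
    cases h₂ with
    | refl => exact h ▸ .braid hik ..
    | comm hkj _ _ z' =>
      have hz' : length z' < L := by rwa [h, length_σ_mul] at hw
      exact (H.trans_comm_braid hkj.symm hik.symm hz' h.symm).symm
    | braid hkj => exact H.trans_braid_braid hik hkj hz h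

end FrontRelBelow

/-- Two words are both empty, or their first letters and the classes of their tails are related
by `FrontRel`. Relating words rather than classes allows induction over the generated
congruence. -/
inductive WordFrontRel (G : SimpleGraph V) : FreeMonoid (V × C) → FreeMonoid (V × C) → Prop
  | one : WordFrontRel G 1 1
  | of_mul {i j : V} {a d : C} {u v : FreeMonoid (V × C)}
      (h : FrontRel i a (.mk (ColArtinRel G C) u) j d (.mk (ColArtinRel G C) v)) :
      WordFrontRel G (.of (i, a) * u) (.of (j, d) * v)

namespace WordFrontRel

variable {L : ℕ} {u v w u' v' : FreeMonoid (V × C)}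

theorem refl (u : FreeMonoid (V × C)) : WordFrontRel G u u := by
  induction u using FreeMonoid.casesOn with
  | one => exact .one
  | of_mul p u => exact .of_mul (.refl ..)

theorem of_colArtinRel (h : ColArtinRel G C u v) : WordFrontRel G u v := by
  cases h with
  | comm hij a b => exact .of_mul (.comm hij a b 1)
  | braid hij a b c => exact .of_mul (.braid hij a b c 1)

theorem symm (h : WordFrontRel G u v) : WordFrontRel G v u := by
  cases h with
  | one => exact .one
  | of_mul h => exact .of_mul h.symm

theorem mul (h : WordFrontRel G u v) (h' : WordFrontRel G u' v')
    (heq : PresentedMonoid.mk (ColArtinRel G C) u' = PresentedMonoid.mk _ v') :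
    WordFrontRel G (u * u') (v * v') := by
  cases h with
  | one => exact h'
  | of_mul h =>
    rw [mul_assoc, mul_assoc]
    refine .of_mul ?_
    rw [map_mul, map_mul, ← heq]
    exact h.mul_right _

theorem trans (H : FrontRelBelow G C L)
    (hv : length (PresentedMonoid.mk (ColArtinRel G C) v) ≤ L + 1)
    (h₁ : WordFrontRel G u v) (h₂ : WordFrontRel G v w) : WordFrontRel G u w := by
  cases h₁ with
  | one => exact h₂
  | of_mul h₁ =>
    rw [length_mk_of_mul, Nat.add_le_add_iff_right] at hv
    cases h₂ with
    | of_mul h₂ => exact .of_mul (H.trans hv h₁ h₂)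

theorem of_conGen (H : FrontRelBelow G C L) (h : ConGen.Rel (ColArtinRel G C) u v)
    (hu : length (PresentedMonoid.mk (ColArtinRel G C) u) ≤ L + 1) : WordFrontRel G u v := by
  induction h with
  | of u v h => exact of_colArtinRel h
  | refl u => exact refl u
  | symm h ih => exact (ih ((PresentedMonoid.mk_eq_mk_iff.2 h).symm ▸ hu)).symm
  | trans h₁ _ ih₁ ih₂ =>
    have hv := (PresentedMonoid.mk_eq_mk_iff.2 h₁) ▸ hu
    exact (ih₁ hu).trans H hv (ih₂ hv)
  | mul _ h' ih ih' =>
    rw [map_mul, length_mul] at hu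
    exact (ih (by omega)).mul (ih' (by omega)) (PresentedMonoid.mk_eq_mk_iff.2 h')

end WordFrontRel

theorem frontRelBelow (G : SimpleGraph V) (C : Type*) (L : ℕ) : FrontRelBelow G C L := by
  induction L with
  | zero => exact fun _ _ _ _ _ _ hx => absurd hx (Nat.not_lt_zero _)
  | succ L H =>
    intro i j a d x y hx h
    induction x using PresentedMonoid.inductionOn with | _ u
    induction y using PresentedMonoid.inductionOn with | _ v
    have hrel : ConGen.Rel (ColArtinRel G C) (.of (i, a) * u) (.of (j, d) * v) :=
      PresentedMonoid.mk_eq_mk_iff.1 h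
    cases WordFrontRel.of_conGen H hrel ((length_mk_of_mul i a u).trans_le hx) with
    | of_mul h => exact h

theorem frontRel_of_σ_mul_eq {x y : ColArtinMonoid G C} (h : σ i a * x = σ j d * y) :
    FrontRel i a x j d y :=
  frontRelBelow G C _ (Nat.lt_succ_self (length x)) h

theorem isLeftRegular_σ (i : V) (a : C) : IsLeftRegular (σ i a : ColArtinMonoid G C) :=
  fun _ _ h => (frontRel_of_σ_mul_eq h).eq_of_same_vertex.2

instance : IsLeftCancelMul (ColArtinMonoid G C) where
  mul_left_cancel x := by
    induction x using σ_induction with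
    | one => exact isRegular_one.left
    | σ_mul i a x ih => exact (isLeftRegular_σ i a).mul ih

/-- Reading words backwards, as a homomorphism to the opposite monoid. -/
def reverse (G : SimpleGraph V) (C : Type*) : ColArtinMonoid G C →* (ColArtinMonoid G C)ᵐᵒᵖ :=
  PresentedMonoid.lift (fun p => .op (σ p.1 p.2)) (by
    rintro _ _ (⟨hij, a, b⟩ | ⟨hij, a, b, c⟩)
    · simp [← MulOpposite.op_mul, σ_mul_σ_comm hij]
    · simp [← MulOpposite.op_mul, ← mul_assoc, σ_mul_σ_mul_σ hij])

theorem reverse_σ (i : V) (a : C) : reverse G C (σ i a) = .op (σ i a) :=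
  PresentedMonoid.lift_of _ _

theorem reverse_involutive :
    Function.Involutive fun x : ColArtinMonoid G C => (reverse G C x).unop := by
  intro x
  induction x using σ_induction with
  | one => simp
  | σ_mul i a x ih => simp [reverse_σ, ih]

theorem reverse_injective : Function.Injective (reverse G C) := fun _ _ h =>
  reverse_involutive.injective (congrArg MulOpposite.unop h)

instance : IsRightCancelMul (ColArtinMonoid G C) :=
  reverse_injective.isRightCancelMul _ (map_mul _)

end ColArtinMonoid

theorem mainTheorem2_general {V : Type*} (G : SimpleGraph V) (C : Type*) :
    IsCancelMul (ColArtinMonoid G C) where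

theorem pathGraph_adj_iff_abs_sub_eq_one {n : ℕ} {i j : Fin n} :
    (SimpleGraph.pathGraph n).Adj i j ↔ |((i : ℕ) : ℤ) - ((j : ℕ) : ℤ)| = 1 := by
  rw [SimpleGraph.pathGraph_adj, abs_eq zero_le_one]
  omega

theorem compl_pathGraph_adj_iff_two_le_abs_sub {n : ℕ} {i j : Fin n} :
    (SimpleGraph.pathGraph n)ᶜ.Adj i j ↔ 2 ≤ |((i : ℕ) : ℤ) - ((j : ℕ) : ℤ)| := by
  rw [SimpleGraph.compl_adj, SimpleGraph.pathGraph_adj, le_abs, ne_eq, Fin.ext_iff]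
  omega

theorem colBraidRel_eq_colArtinRel (n : ℕ) (C : Type*) :
    ColBraidRel n C = ColArtinRel (SimpleGraph.pathGraph n) C := by
  ext u v
  constructor
  · rintro (⟨i, j, a, b, h⟩ | ⟨i, j, a, b, c, h⟩)
    · exact .comm (compl_pathGraph_adj_iff_two_le_abs_sub.2 h) a b
    · exact .braid (pathGraph_adj_iff_abs_sub_eq_one.2 h) a b c
  · rintro (⟨hij, a, b⟩ | ⟨hij, a, b, c⟩)
    · exact .comm _ _ a b (compl_pathGraph_adj_iff_two_le_abs_sub.1 hij)
    · exact .braid _ _ a b c (pathGraph_adj_iff_abs_sub_eq_one.1 hij)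

theorem mainTheorem2 (n : ℕ) (C : Type*) [Nonempty C] :
    IsLeftCancelMul (ColBraidMonoid n C) ∧ IsRightCancelMul (ColBraidMonoid n C) := by
  unfold ColBraidMonoid
  rw [colBraidRel_eq_colArtinRel, ← isCancelMul_iff]
  exact mainTheorem2_general (SimpleGraph.pathGraph n) C
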